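/- Let $f:\mathbb R\to\mathbb C$ be $2\pi$-periodic and integrable on $[-\pi,\pi]$, with Fourier coefficients $\hat f(k)=\frac1{2\pi}\int_{-\pi}^{\pi}f(x)e^{-ikx}\,dx$ $(k\in\mathbb Z)$ and partial sums $S_n(f,x)=\sum_{k=-n}^{n}\hat f(k)e^{ikx}$; write $\|g\|=\int_{-\pi}^{\pi}|g(x)|\,dx$. For $k\ge 0$ put $\Delta\hat f(k)=\hat f(k)-\hat f(k+1)$ and $\Delta\hat f(-k)=\hat f(-k)-\hat f(-k-1)$. Suppose that (a) the balance condition $$\lim_{\lambda\to1^+}\ \limsup_{n\to\infty}\ \sum_{k=n}^{[\lambda n]}\bigl|\Delta\hat f(k)-\Delta\hat f(-k)\bigr|\log k=0$$ holds (the upper limits being taken in $[0,\infty]$), and (b) the sequence $\{\hat f(n)\}_{n\ge0}$ belongs to the class GBV. Here $\{c_n\}$ belongs to GBV if there are $\theta_1\in[0,\pi/2)$, an integer $N_0\ge1$ and a constant $M>0$ such that $c_n\in K(\theta_1):=\{0\}\cup\{z\neq0:|\arg z|\le\theta_1\}$ for all $n\ge1$, where $\arg$ takes values in $(-\pi,\pi]$,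 and $$\sum_{n=m}^{2m}|c_n-c_{n+1}|\le M\max_{m\le n<m+N_0}|c_n|\qquad\text{for all } m\ge1 .$$ Then $$\lim_{n\to\infty}\|f-S_n(f)\|=0\quad\text{if and only if}\quad\lim_{|n|\to\infty}\hat f(n)\log|n|=0,$$ where in the second limit $n$ runs through all integers, positive and negative. -/

import Mathlib

open Real Filter Topology MeasureTheory

noncomputable section

namespace L1Fourier

/-- The difference `Δ c_n = c_n - c_{n+1}` of a sequence. -/
def delta (c : ℕ → ℂ) (n : ℕ) : ℂ := c n - c (n + 1)

/-- The sector `K(θ) = {z : |arg z| ≤ θ}`; it contains `0`, since `arg 0 = 0` in Mathlib. -/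
def sector (θ : ℝ) : Set ℂ := {z | |Complex.arg z| ≤ θ}

/-- The class GBV. Membership of `c` only concerns the terms `c 1, c 2, …`;
the value `c 0` is irrelevant. -/
def GBV (c : ℕ → ℂ) : Prop :=
  (∃ θ : ℝ, 0 ≤ θ ∧ θ < π / 2 ∧ ∀ n : ℕ, 1 ≤ n → c n ∈ sector θ) ∧
  ∃ (N₀ : ℕ) (hN : 0 < N₀), ∃ M : ℝ, 0 < M ∧ ∀ m : ℕ, 1 ≤ m →
    ∑ n ∈ Finset.Icc m (2 * m), ‖delta c n‖ ≤
      M * (Finset.Ico m (m + N₀)).sup'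
        (Finset.nonempty_Ico.2 (Nat.lt_add_of_pos_right hN)) (fun n => ‖c n‖)

/-- The Fourier coefficient `(1 / 2π) ∫_{-π}^{π} f(x) e^{-ikx} dx`. -/
def fhat (f : ℝ → ℂ) (k : ℤ) : ℂ := fourierCoeffOn (neg_lt_self Real.pi_pos) f k

/-- The symmetric partial sum `S_n(f, x) = ∑_{k=-n}^{n} f̂(k) e^{ikx}`. -/
def partialSum (f : ℝ → ℂ) (n : ℕ) (x : ℝ) : ℂ :=
  ∑ k ∈ Finset.Icc (-(n : ℤ)) (n : ℤ), fhat f k * Complex.exp (Complex.I * k * x)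

/-- The norm `‖g‖ = ∫_{-π}^{π} |g(x)| dx` of `L_{2π}`. -/
def L1norm (g : ℝ → ℂ) : ℝ := ∫ x in (-π)..π, ‖g x‖

/-- The sum `∑_{k=n}^{[λn]} |Δf̂(k) - Δf̂(-k)| log k`, where `Δf̂(-k) = f̂(-k) - f̂(-k-1)` is the
difference of the sequence `j ↦ f̂(-j)`. -/
def balanceSum (f : ℝ → ℂ) (lam : ℝ) (n : ℕ) : ℝ :=
  ∑ k ∈ Finset.Icc n ⌊lam * n⌋₊,
    ‖delta (fun j : ℕ => fhat f (j : ℤ)) k - delta (fun j : ℕ => fhat f (-(j : ℤ))) k‖ *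
      Real.log k

end L1Fourier

end

/-!
Convergence in `L¹` of the Fourier series amounts to the smallness of the blocks
`∑_{n<|k|≤m} f̂(k) e^{ikx}`.

*Necessity.* Testing a block against the sawtooth function gives Hardy's inequality
`|∑ a_k / (k - n)| ≤ ½ ‖∑ a_k e^{ikx}‖`. For coefficients in a sector it bounds
`∑_{n<k≤2n} |f̂(k)| / (k - n)`, and since a term of a sequence in GBV is dominated by every window
of fixed length in the preceding dyadic block, this sum is at least of order `|f̂(p)| log p` for
`p ∈ {2n, 2n + 1}`. The same inequality, over the block `n < k ≤ λn` on which `f̂(k) - f̂(-k)` varies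
little by the balance condition, gives `(f̂(n) - f̂(-n)) log n → 0`.

*Sufficiency.* Summation by parts against `∑_{k<n} e^{ikx}`, whose `L¹` norm is `O(log n)`, shows
that the blocks `n < |k| ≤ λn` are small. The means of `S_0 f, …, S_{n-1} f` converge to `f` in `L¹`
by Fejér's theorem, and small blocks upgrade this to the convergence of `S_n f`.
-/

namespace L1Fourier

section Exponentials

/-- The character `x ↦ e^{ikx}`, in the form in which it occurs in `partialSum`. -/
noncomputable def expI (k : ℤ) (x : ℝ) : ℂ := Complex.exp (Complex.I * k * x)

@[fun_prop]
theorem continuous_expI (k : ℤ) : Continuous (expI k) := by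
  unfold expI; fun_prop

theorem norm_expI (k : ℤ) (x : ℝ) : ‖expI k x‖ = 1 := by
  have : Complex.I * k * x = ((k * x : ℝ) : ℂ) * Complex.I := by push_cast; ring
  rw [expI, this, Complex.norm_exp_ofReal_mul_I]

theorem expI_zero (x : ℝ) : expI 0 x = 1 := by simp [expI]

theorem expI_apply_zero (k : ℤ) : expI k 0 = 1 := by simp [expI]

theorem expI_add (j k : ℤ) (x : ℝ) : expI (j + k) x = expI j x * expI k x := by
  simp only [expI, ← Complex.exp_add]; congr 1; push_cast; ring

theorem expI_natCast (n : ℕ) (x : ℝ) : expI n x = expI 1 x ^ n := by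
  simp only [expI, ← Complex.exp_nat_mul]; congr 1; push_cast; ring

theorem expI_apply_neg (k : ℤ) (x : ℝ) : expI k (-x) = expI (-k) x := by
  simp [expI]

theorem expI_apply_sub (k : ℤ) (x y : ℝ) : expI k (x - y) = expI k x * expI (-k) y := by
  simp only [expI, ← Complex.exp_add]; congr 1; push_cast; ring

theorem conj_expI (k : ℤ) (x : ℝ) : (starRingEnd ℂ) (expI k x) = expI (-k) x := by
  simp [expI, ← Complex.exp_conj]

theorem periodic_expI (k : ℤ) : Function.Periodic (expI k) (2 * π) := fun x => by
  have : Complex.I * k * ((x + 2 * π : ℝ) : ℂ) =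
      Complex.I * k * x + k * (2 * π * Complex.I) := by push_cast; ring
  rw [expI, this, Complex.exp_add, Complex.exp_int_mul_two_pi_mul_I, mul_one, expI]

theorem hasDerivAt_expI (k : ℤ) (x : ℝ) :
    HasDerivAt (expI k) (expI k x * (Complex.I * k)) x := by
  have h := ((Complex.ofRealCLM.hasDerivAt (x := x)).const_mul (Complex.I * k)).cexp
  simpa only [Complex.ofRealCLM_apply, Complex.ofReal_one, mul_one] using! h

theorem integral_expI (k : ℤ) :
    ∫ x in (-π)..π, expI k x = if k = 0 then (2 * π : ℂ) else 0 := by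
  split_ifs with hk
  · simp only [hk, expI_zero, intervalIntegral.integral_const, Complex.real_smul]
    push_cast; ring
  · have hk' : Complex.I * (k : ℂ) ≠ 0 := mul_ne_zero Complex.I_ne_zero (by exact_mod_cast hk)
    have hends : expI k π = expI k (-π) := by
      rw [← periodic_expI k (-π)]; congr 1; ring
    simp only [expI] at hends ⊢
    rw [integral_exp_mul_complex hk', hends, sub_self, zero_div]

theorem integral_sub_pi_mul_expI {k : ℤ} (hk : k ≠ 0) :
    ∫ x in (0)..(2 * π), ((x - π : ℝ) : ℂ) * expI k x = 2 * π / (Complex.I * k) := by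
  have hk' : (k : ℂ) ≠ 0 := by exact_mod_cast hk
  have hderiv : ∀ x ∈ Set.uIcc 0 (2 * π), HasDerivAt
      (fun x : ℝ => ((x - π : ℝ) : ℂ) * expI k x / (Complex.I * k) + expI k x / (k : ℂ) ^ 2)
      (((x - π : ℝ) : ℂ) * expI k x) x := fun x _ => by
    have hlin : HasDerivAt (fun x : ℝ => ((x - π : ℝ) : ℂ)) 1 x := by
      simpa using ((hasDerivAt_id x).sub_const π).ofReal_comp
    convert! ((hlin.mul (hasDerivAt_expI k x)).div_const (Complex.I * k)).add
      ((hasDerivAt_expI k x).div_const ((k : ℂ) ^ 2)) using 1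
    field_simp [Complex.I_ne_zero]
    linear_combination (-expI k x) * Complex.I_sq
  have hcont : Continuous fun x : ℝ => ((x - π : ℝ) : ℂ) * expI k x := by fun_prop
  rw [intervalIntegral.integral_eq_sub_of_hasDerivAt hderiv (hcont.intervalIntegrable _ _),
    (periodic_expI k).eq, expI_apply_zero]
  push_cast
  field_simp [Complex.I_ne_zero]
  ring

theorem fourier_eq_expI {T : ℝ} (hT : T = 2 * π) (k : ℤ) (x : ℝ) :
    fourier k (x : AddCircle T) = expI k x := by
  have hpi : (π : ℂ) ≠ 0 := by exact_mod_cast pi_ne_zero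
  rw [fourier_coe_apply, expI, hT]
  congr 1
  push_cast
  field_simp

end Exponentials

section L1norm

variable {f g : ℝ → ℂ}

theorem L1norm_nonneg (f : ℝ → ℂ) : 0 ≤ L1norm f :=
  intervalIntegral.integral_nonneg (by linarith [pi_pos]) fun _ _ => norm_nonneg _

theorem L1norm_neg (f : ℝ → ℂ) : L1norm (-f) = L1norm f := by
  simp only [L1norm, Pi.neg_apply, norm_neg]

theorem L1norm_const_mul (a : ℂ) (f : ℝ → ℂ) : L1norm (fun x => a * f x) = ‖a‖ * L1norm f := by
  simp only [L1norm, norm_mul, intervalIntegral.integral_const_mul]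

theorem L1norm_comp_neg (f : ℝ → ℂ) : L1norm (fun x => f (-x)) = L1norm f := by
  simpa only [L1norm, neg_neg] using
    intervalIntegral.integral_comp_neg (a := -π) (b := π) fun x => ‖f x‖

theorem L1norm_mono (hf : IntervalIntegrable f volume (-π) π) {u : ℝ → ℝ}
    (hu : IntervalIntegrable u volume (-π) π) (hfu : ∀ x, ‖f x‖ ≤ u x) :
    L1norm f ≤ ∫ x in (-π)..π, u x :=
  intervalIntegral.integral_mono_on (by linarith [pi_pos]) hf.norm hu fun x _ => hfu x

theorem L1norm_add_le (hf : IntervalIntegrable f volume (-π) π)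
    (hg : IntervalIntegrable g volume (-π) π) :
    L1norm (fun x => f x + g x) ≤ L1norm f + L1norm g :=
  (L1norm_mono (hf.add hg) (hf.norm.add hg.norm) fun _ => norm_add_le _ _).trans_eq
    (intervalIntegral.integral_add hf.norm hg.norm)

theorem L1norm_sub_le (hf : IntervalIntegrable f volume (-π) π)
    (hg : IntervalIntegrable g volume (-π) π) :
    L1norm (fun x => f x - g x) ≤ L1norm f + L1norm g := by
  simpa only [Pi.neg_apply, ← sub_eq_add_neg, L1norm_neg] using L1norm_add_le hf hg.neg

theorem L1norm_sum_le {ι : Type*} (s : Finset ι) {u : ι → ℝ → ℂ}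
    (hu : ∀ i ∈ s, IntervalIntegrable (u i) volume (-π) π) :
    L1norm (fun x => ∑ i ∈ s, u i x) ≤ ∑ i ∈ s, L1norm (u i) := by
  refine (L1norm_mono ?_ ?_ fun x => norm_sum_le s fun i => u i x).trans_eq
    (intervalIntegral.integral_finsetSum fun i hi => (hu i hi).norm)
  · simpa only [Finset.sum_fn] using IntervalIntegrable.sum s hu
  · simpa only [Finset.sum_fn] using IntervalIntegrable.sum s fun i hi => (hu i hi).norm

theorem L1norm_eq_of_periodic (hf : Function.Periodic f (2 * π)) (t : ℝ) :
    L1norm f = ∫ x in t..(t + 2 * π), ‖f x‖ := by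
  have h := (hf.comp norm).intervalIntegral_add_eq (-π) t
  rwa [show -π + 2 * π = π by ring] at h

theorem L1norm_convolution_le {K : ℝ → ℂ} (hK : Continuous K)
    (hper : Function.Periodic K (2 * π)) (hf : IntervalIntegrable f volume (-π) π) :
    L1norm (fun x => ∫ y in (-π)..π, K (x - y) * f y) ≤ L1norm K * L1norm f := by
  have hle : -π ≤ π := by linarith [pi_pos]
  set μ : Measure ℝ := volume.restrict (Set.Ioc (-π) π)
  have hf' : Integrable f μ := (intervalIntegrable_iff_integrableOn_Ioc_of_le hle).1 hf
  obtain ⟨C, hC⟩ := (hper.isBounded_of_continuous (by positivity) hK).exists_norm_le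
  have hprod : Integrable (Function.uncurry fun x y : ℝ => K (x - y) * f y) (μ.prod μ) := by
    have hf₂ : Integrable (fun p : ℝ × ℝ => f p.2) (μ.prod μ) := hf'.comp_snd μ
    exact hf₂.bdd_mul (by fun_prop) (Eventually.of_forall fun p => hC _ (Set.mem_range_self _))
  have hshift : ∀ y, ∫ x in (-π)..π, ‖K (x - y)‖ = L1norm K := fun y => by
    rw [intervalIntegral.integral_comp_sub_right (fun x => ‖K x‖) y,
      L1norm_eq_of_periodic hper (-π - y)]
    congr 1; ring
  calc L1norm (fun x => ∫ y in (-π)..π, K (x - y) * f y)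
      ≤ ∫ x in (-π)..π, ∫ y in (-π)..π, ‖K (x - y) * f y‖ := by
        simp only [L1norm, intervalIntegral.integral_of_le hle]
        exact integral_mono hprod.integral_prod_left.norm hprod.norm.integral_prod_left
          fun x => norm_integral_le_integral_norm _
    _ = ∫ y in (-π)..π, ∫ x in (-π)..π, ‖K (x - y) * f y‖ := by
        simp only [intervalIntegral.integral_of_le hle]
        exact integral_integral_swap hprod.norm
    _ = L1norm K * L1norm f := by
        simp only [norm_mul, intervalIntegral.integral_mul_const, hshift,
          intervalIntegral.integral_const_mul]
        rfl

end L1norm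

section TrigPoly

/-- The trigonometric polynomial with frequencies in `s` and coefficients `a`. -/
noncomputable def trigPoly (a : ℤ → ℂ) (s : Finset ℤ) (x : ℝ) : ℂ := ∑ k ∈ s, a k * expI k x

@[fun_prop]
theorem continuous_trigPoly (a : ℤ → ℂ) (s : Finset ℤ) : Continuous (trigPoly a s) :=
  continuous_finsetSum _ fun k _ => continuous_const.mul (continuous_expI k)

theorem periodic_trigPoly (a : ℤ → ℂ) (s : Finset ℤ) :
    Function.Periodic (trigPoly a s) (2 * π) := fun x =>
  Finset.sum_congr rfl fun k _ => by rw [periodic_expI k x]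

theorem intervalIntegrable_trigPoly (a : ℤ → ℂ) (s : Finset ℤ) :
    IntervalIntegrable (trigPoly a s) volume (-π) π :=
  (continuous_trigPoly a s).intervalIntegrable _ _

theorem integral_sub_pi_mul_trigPoly (a : ℤ → ℂ) {s : Finset ℤ} {n : ℤ} (hn : n ∉ s) :
    ∫ x in (0)..(2 * π), ((x - π : ℝ) : ℂ) * expI (-n) x * trigPoly a s x =
      2 * π / Complex.I * ∑ k ∈ s, a k / (k - n) := by
  have hexpand : ∀ x : ℝ, ((x - π : ℝ) : ℂ) * expI (-n) x * trigPoly a s x =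
      ∑ k ∈ s, a k * (((x - π : ℝ) : ℂ) * expI (k - n) x) := fun x => by
    rw [trigPoly, Finset.mul_sum]
    refine Finset.sum_congr rfl fun k _ => ?_
    rw [sub_eq_add_neg k n, expI_add]
    ring
  simp only [hexpand]
  rw [intervalIntegral.integral_finsetSum fun k _ =>
    (by fun_prop : Continuous _).intervalIntegrable _ _, Finset.mul_sum]
  refine Finset.sum_congr rfl fun k hk => ?_
  have hkn : k - n ≠ 0 := sub_ne_zero.2 fun h => hn (h ▸ hk)
  rw [intervalIntegral.integral_const_mul, integral_sub_pi_mul_expI hkn, div_mul_div_comm]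
  push_cast
  ring

/-- Tested against the sawtooth `x - π` on `[0, 2π]`, whose Fourier coefficients are `i / k`. -/
theorem norm_sum_div_sub_le_L1norm (a : ℤ → ℂ) {s : Finset ℤ} {n : ℤ} (hn : n ∉ s) :
    ‖∑ k ∈ s, a k / (k - n)‖ ≤ 1 / 2 * L1norm (trigPoly a s) := by
  have hpi := pi_pos
  have hbound : ‖∫ x in (0)..(2 * π), ((x - π : ℝ) : ℂ) * expI (-n) x * trigPoly a s x‖ ≤
      π * L1norm (trigPoly a s) := by
    rw [L1norm_eq_of_periodic (periodic_trigPoly a s) 0, zero_add,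
      ← intervalIntegral.integral_const_mul]
    refine intervalIntegral.norm_integral_le_of_norm_le (by positivity)
      (Eventually.of_forall fun x hx => ?_) ((by fun_prop : Continuous _).intervalIntegrable _ _)
    rw [norm_mul, norm_mul, norm_expI, mul_one, Complex.norm_real]
    gcongr
    exact abs_le.2 ⟨by linarith [hx.1], by linarith [hx.2]⟩
  have hnorm : ‖(2 * π / Complex.I : ℂ)‖ = 2 * π := by simp [abs_of_pos hpi]
  rw [integral_sub_pi_mul_trigPoly a hn, norm_mul, hnorm, mul_comm 2 π, mul_assoc] at hbound
  linarith [le_of_mul_le_mul_left hbound hpi]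

end TrigPoly

section FourierCoefficients

variable {f g : ℝ → ℂ}

theorem fhat_eq_integral (f : ℝ → ℂ) (k : ℤ) :
    fhat f k = (2 * π : ℂ)⁻¹ * ∫ x in (-π)..π, expI (-k) x * f x := by
  rw [fhat, fourierCoeffOn_eq_integral]
  simp only [fourier_eq_expI (show π - -π = 2 * π by ring), smul_eq_mul, Complex.real_smul]
  congr 1
  push_cast; ring

theorem intervalIntegrable_expI_mul (hf : IntervalIntegrable f volume (-π) π) (k : ℤ) :
    IntervalIntegrable (fun x => expI k x * f x) volume (-π) π :=
  hf.continuousOn_mul (continuous_expI k).continuousOn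

theorem fhat_sub (hf : IntervalIntegrable f volume (-π) π)
    (hg : IntervalIntegrable g volume (-π) π) (k : ℤ) :
    fhat (fun x => f x - g x) k = fhat f k - fhat g k := by
  simp only [fhat_eq_integral, mul_sub]
  rw [intervalIntegral.integral_sub (intervalIntegrable_expI_mul hf _)
    (intervalIntegrable_expI_mul hg _), mul_sub]

theorem norm_fhat_le (f : ℝ → ℂ) (k : ℤ) : ‖fhat f k‖ ≤ (2 * π)⁻¹ * L1norm f := by
  have hpi := pi_pos
  have h := intervalIntegral.norm_integral_le_integral_norm (μ := volume)
    (f := fun x => expI (-k) x * f x) (neg_le_self hpi.le)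
  simp only [norm_mul, norm_expI, one_mul] at h
  rw [fhat_eq_integral, norm_mul, norm_inv]
  gcongr
  · simp [abs_of_pos hpi]
  · exact h

theorem fhat_trigPoly (a : ℤ → ℂ) (s : Finset ℤ) (k : ℤ) :
    fhat (trigPoly a s) k = if k ∈ s then a k else 0 := by
  have hexpand : ∀ x : ℝ, expI (-k) x * trigPoly a s x = ∑ j ∈ s, a j * expI (j - k) x :=
    fun x => by
      rw [trigPoly, Finset.mul_sum]
      refine Finset.sum_congr rfl fun j _ => ?_
      rw [sub_eq_add_neg, expI_add]
      ring
  simp only [fhat_eq_integral, hexpand]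
  rw [intervalIntegral.integral_finsetSum fun j _ =>
    (by fun_prop : Continuous _).intervalIntegrable _ _]
  simp only [intervalIntegral.integral_const_mul, integral_expI, sub_eq_zero, mul_ite, mul_zero,
    Finset.sum_ite_eq']
  have hpi : (2 * π : ℂ) ≠ 0 := by exact_mod_cast Real.two_pi_pos.ne'
  split_ifs
  exacts [by rw [mul_left_comm, inv_mul_cancel₀ hpi, mul_one], rfl]

theorem norm_coeff_le_L1norm_trigPoly (a : ℤ → ℂ) {s : Finset ℤ} {k : ℤ} (hk : k ∈ s) :
    ‖a k‖ ≤ (2 * π)⁻¹ * L1norm (trigPoly a s) := by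
  simpa only [fhat_trigPoly, if_pos hk] using norm_fhat_le (trigPoly a s) k

theorem partialSum_eq_trigPoly (f : ℝ → ℂ) (n : ℕ) :
    partialSum f n = trigPoly (fhat f) (Finset.Icc (-n) n) := rfl

@[fun_prop]
theorem continuous_partialSum (f : ℝ → ℂ) (n : ℕ) : Continuous (partialSum f n) :=
  continuous_trigPoly _ _

theorem partialSum_sub (hf : IntervalIntegrable f volume (-π) π)
    (hg : IntervalIntegrable g volume (-π) π) (n : ℕ) (x : ℝ) :
    partialSum (fun x => f x - g x) n x = partialSum f n x - partialSum g n x := by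
  simp only [partialSum_eq_trigPoly, trigPoly, fhat_sub hf hg, sub_mul, Finset.sum_sub_distrib]

theorem partialSum_trigPoly (a : ℤ → ℂ) {s : Finset ℤ} {n : ℕ} (hs : s ⊆ Finset.Icc (-n) n) :
    partialSum (trigPoly a s) n = trigPoly a s := by
  ext x
  change ∑ k ∈ Finset.Icc (-(n : ℤ)) n, fhat (trigPoly a s) k * expI k x = ∑ k ∈ s, a k * expI k x
  simp only [fhat_trigPoly, ite_mul, zero_mul]
  rw [← Finset.sum_filter, Finset.filter_mem_eq_inter, Finset.inter_eq_right.2 hs]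

end FourierCoefficients

section Shell

/-- The frequencies `k` with `n < |k| ≤ m`, which occur in `S_m - S_n`. -/
noncomputable def shell (n m : ℕ) : Finset ℤ := Finset.Icc (-m) m \ Finset.Icc (-n) n

theorem mem_shell {n m : ℕ} {k : ℤ} : k ∈ shell n m ↔ n < k.natAbs ∧ k.natAbs ≤ m := by
  simp only [shell, Finset.mem_sdiff, Finset.mem_Icc]
  omega

theorem sum_shell {M : Type*} [AddCommMonoid M] (g : ℤ → M) (n m : ℕ) :
    ∑ k ∈ shell n m, g k = ∑ k ∈ Finset.Ioc n m, (g k + g (-k)) := by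
  have himage : shell n m = (Finset.Ioc n m).image (fun k : ℕ => (k : ℤ)) ∪
      (Finset.Ioc n m).image (fun k : ℕ => -(k : ℤ)) := by
    ext k
    simp only [mem_shell, Finset.mem_union, Finset.mem_image, Finset.mem_Ioc]
    constructor
    · rintro hk
      rcases k.natAbs_eq with h | h
      exacts [.inl ⟨_, hk, h.symm⟩, .inr ⟨_, hk, h.symm⟩]
    · rintro (⟨j, hj, rfl⟩ | ⟨j, hj, rfl⟩) <;> simpa using hj
  have hdisj : Disjoint ((Finset.Ioc n m).image (fun k : ℕ => (k : ℤ)))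
      ((Finset.Ioc n m).image (fun k : ℕ => -(k : ℤ))) := by
    simp only [Finset.disjoint_left, Finset.mem_image, Finset.mem_Ioc]
    rintro _ ⟨j, hj, rfl⟩ ⟨i, _, hij⟩
    omega
  rw [himage, Finset.sum_union hdisj, Finset.sum_image (by simp), Finset.sum_image (by simp),
    Finset.sum_add_distrib]

theorem partialSum_sub_partialSum (f : ℝ → ℂ) {n m : ℕ} (hnm : n ≤ m) (x : ℝ) :
    partialSum f m x - partialSum f n x = trigPoly (fhat f) (shell n m) x :=
  sub_eq_of_eq_add (Finset.sum_sdiff (Finset.Icc_subset_Icc (by omega) (by omega))).symm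

theorem L1norm_trigPoly_shell_neg (a : ℤ → ℂ) (n m : ℕ) :
    L1norm (trigPoly (fun k => a (-k)) (shell n m)) = L1norm (trigPoly a (shell n m)) := by
  rw [← L1norm_comp_neg]
  congr 1 with x
  simp only [trigPoly, expI_apply_neg, sum_shell, neg_neg, add_comm]

end Shell

section ExpSum

/-- The one-sided kernel `∑_{k < n} e^{ikx}`, with respect to which the analytic half of a
trigonometric series is summed by parts. -/
noncomputable def expSum (n : ℕ) (x : ℝ) : ℂ := ∑ k ∈ Finset.range n, expI k x

@[fun_prop]
theorem continuous_expSum (n : ℕ) : Continuous (expSum n) :=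
  continuous_finsetSum _ fun _ _ => continuous_expI _

theorem expSum_succ (n : ℕ) (x : ℝ) : expSum (n + 1) x = expSum n x + expI n x :=
  Finset.sum_range_succ _ _

theorem norm_expSum_le (n : ℕ) (x : ℝ) : ‖expSum n x‖ ≤ n :=
  (norm_sum_le _ _).trans_eq (by simp [norm_expI])

theorem conj_expSum (n : ℕ) (x : ℝ) : (starRingEnd ℂ) (expSum n x) = expSum n (-x) := by
  simp only [expSum, map_sum, conj_expI, expI_apply_neg]

theorem norm_expSum_neg (n : ℕ) (x : ℝ) : ‖expSum n (-x)‖ = ‖expSum n x‖ := by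
  rw [← conj_expSum, Complex.norm_conj]

theorem expSum_mul_sub_one (n : ℕ) (x : ℝ) : expSum n x * (expI 1 x - 1) = expI n x - 1 := by
  simp only [expSum, expI_natCast, geom_sum_mul]

theorem two_div_pi_mul_le_norm_expI_one_sub_one {x : ℝ} (hx : 0 ≤ x) (hx' : x ≤ π) :
    2 / π * x ≤ ‖expI 1 x - 1‖ := by
  have hsin := Real.mul_le_sin (x := x / 2) (by positivity) (by linarith)
  rw [expI, Int.cast_one, mul_one, Complex.norm_exp_I_mul_ofReal_sub_one, Real.norm_eq_abs,
    abs_mul, abs_two]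
  linarith [le_abs_self (sin (x / 2))]

theorem norm_expSum_le_pi_div (n : ℕ) {x : ℝ} (hx : 0 < x) (hx' : x ≤ π) :
    ‖expSum n x‖ ≤ π / x := by
  have hgeom : ‖expSum n x‖ * ‖expI 1 x - 1‖ ≤ 2 := by
    rw [← norm_mul, expSum_mul_sub_one]
    exact (norm_sub_le _ _).trans_eq (by rw [norm_expI, norm_one, one_add_one_eq_two])
  calc ‖expSum n x‖ = ‖expSum n x‖ * (2 / π * x) * (π / x / 2) := by field_simp
    _ ≤ 2 * (π / x / 2) := by
        gcongr
        exact (mul_le_mul_of_nonneg_left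
          (two_div_pi_mul_le_norm_expI_one_sub_one hx.le hx') (norm_nonneg _)).trans hgeom
    _ = π / x := by ring

theorem L1norm_expSum_eq (n : ℕ) : L1norm (expSum n) = 2 * ∫ x in (0)..π, ‖expSum n x‖ := by
  have hint : ∀ a b, IntervalIntegrable (fun x => ‖expSum n x‖) volume a b :=
    (continuous_expSum n).norm.intervalIntegrable
  have hneg : ∫ x in (-π)..0, ‖expSum n x‖ = ∫ x in (0)..π, ‖expSum n x‖ := by
    simpa only [norm_expSum_neg, neg_zero, neg_neg] using
      intervalIntegral.integral_comp_neg (a := -π) (b := 0) fun x => ‖expSum n x‖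
  rw [L1norm, ← intervalIntegral.integral_add_adjacent_intervals (hint _ 0) (hint 0 _), hneg,
    two_mul]

theorem L1norm_expSum_le {n : ℕ} (hn : n ≠ 0) :
    L1norm (expSum n) ≤ 2 * (1 + π * log (π * n)) := by
  have hpi := pi_gt_three
  have hpos : 0 < (n : ℝ)⁻¹ := by positivity
  have hle : (n : ℝ)⁻¹ ≤ π := (Nat.cast_inv_le_one n).trans (by linarith)
  have hint : ∀ a b, IntervalIntegrable (fun x => ‖expSum n x‖) volume a b :=
    (continuous_expSum n).norm.intervalIntegrable
  have hnear : ∫ x in (0)..(n : ℝ)⁻¹, ‖expSum n x‖ ≤ 1 :=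
    calc ∫ x in (0)..(n : ℝ)⁻¹, ‖expSum n x‖ ≤ ∫ _ in (0)..(n : ℝ)⁻¹, (n : ℝ) :=
          intervalIntegral.integral_mono_on hpos.le (hint _ _)
            (continuous_const.intervalIntegrable _ _) fun x _ => norm_expSum_le n x
      _ = 1 := by
          rw [intervalIntegral.integral_const, sub_zero, smul_eq_mul]
          exact inv_mul_cancel₀ (by exact_mod_cast hn)
  have hfar : ∫ x in (n : ℝ)⁻¹..π, ‖expSum n x‖ ≤ π * log (π * n) :=
    calc ∫ x in (n : ℝ)⁻¹..π, ‖expSum n x‖ ≤ ∫ x in (n : ℝ)⁻¹..π, π * x⁻¹ := by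
          refine intervalIntegral.integral_mono_on hle (hint _ _) ?_ fun x hx =>
            norm_expSum_le_pi_div n (hpos.trans_le hx.1) hx.2
          refine (intervalIntegral.intervalIntegrable_inv (fun x hx => ?_)
            continuousOn_id).const_mul π
          rw [Set.uIcc_of_le hle] at hx
          exact (hpos.trans_le hx.1).ne'
      _ = π * log (π * n) := by
          rw [intervalIntegral.integral_const_mul, integral_inv_of_pos hpos (by linarith),
            div_inv_eq_mul]
  rw [L1norm_expSum_eq, ← intervalIntegral.integral_add_adjacent_intervals (hint 0 (n : ℝ)⁻¹)
    (hint _ π)]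
  linarith

theorem exists_L1norm_expSum_succ_le_log :
    ∃ C : ℝ, 0 < C ∧ ∀ n : ℕ, 2 ≤ n → L1norm (expSum (n + 1)) ≤ C * log n := by
  have hpi := pi_gt_three
  have hlogpi : 0 < log π := log_pos (by linarith)
  have hlog2 : 0 < log 2 := log_pos one_lt_two
  refine ⟨(2 + 2 * π * log π) / log 2 + 4 * π, by positivity, fun n hn => ?_⟩
  have hn' : (2 : ℝ) ≤ n := by exact_mod_cast hn
  have hsq : log (n + 1) ≤ 2 * log n := by
    rw [← Nat.cast_two, ← log_pow]
    exact log_le_log (by positivity) (by nlinarith)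
  calc L1norm (expSum (n + 1)) ≤ 2 * (1 + π * log (π * (n + 1))) := by
        exact_mod_cast L1norm_expSum_le n.succ_ne_zero
    _ = 2 + 2 * π * log π + 2 * π * log (n + 1) := by
        rw [log_mul (by positivity) (by positivity)]; ring
    _ ≤ (2 + 2 * π * log π) / log 2 * log n + 2 * π * (2 * log n) := by
        gcongr
        rw [div_mul_eq_mul_div, le_div_iff₀ hlog2]
        gcongr
    _ = ((2 + 2 * π * log π) / log 2 + 4 * π) * log n := by ring

theorem sum_Ioc_mul_expI (c : ℕ → ℂ) {n m : ℕ} (hnm : n ≤ m) (x : ℝ) :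
    ∑ k ∈ Finset.Ioc n m, c k * expI k x =
      c m * expSum (m + 1) x - c n * expSum (n + 1) x +
        ∑ k ∈ Finset.Ico n m, delta c k * expSum (k + 1) x := by
  induction m, hnm using Nat.le_induction with
  | base => simp
  | succ m hm ih =>
    rw [Finset.sum_Ioc_succ_top (by omega), ih, Finset.sum_Ico_succ_top hm,
      expSum_succ (m + 1), delta]
    ring

end ExpSum

section LogVariation

variable {c d : ℕ → ℂ} {n m : ℕ}

/-- The logarithmically weighted variation `∑_{n ≤ k < m} |Δc_k| log k`. -/
noncomputable def logVariation (c : ℕ → ℂ) (n m : ℕ) : ℝ :=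
  ∑ k ∈ Finset.Ico n m, ‖delta c k‖ * log k

theorem delta_sub (c d : ℕ → ℂ) : delta (c - d) = delta c - delta d := by
  ext n; simp only [delta, Pi.sub_apply]; ring

theorem norm_delta_mul_log_nonneg (c : ℕ → ℂ) (k : ℕ) : 0 ≤ ‖delta c k‖ * log k :=
  mul_nonneg (norm_nonneg _) (log_natCast_nonneg k)

theorem logVariation_nonneg (c : ℕ → ℂ) (n m : ℕ) : 0 ≤ logVariation c n m :=
  Finset.sum_nonneg fun k _ => norm_delta_mul_log_nonneg c k

theorem logVariation_mono (c : ℕ → ℂ) (n : ℕ) : Monotone (logVariation c n) := fun _ _ hjm =>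
  Finset.sum_le_sum_of_subset_of_nonneg (Finset.Ico_subset_Ico_right hjm) fun k _ _ =>
    norm_delta_mul_log_nonneg c k

theorem logVariation_sub_le (c d : ℕ → ℂ) (n m : ℕ) :
    logVariation (c - d) n m ≤ logVariation c n m + logVariation d n m := by
  simp only [logVariation, ← Finset.sum_add_distrib, ← add_mul, delta_sub, Pi.sub_apply]
  gcongr with k
  exact norm_sub_le _ _

theorem norm_sub_mul_log_le_logVariation (c : ℕ → ℂ) (hnm : n ≤ m) :
    ‖c m - c n‖ * log n ≤ logVariation c n m := by
  rw [← Finset.sum_Ico_sub c hnm, logVariation]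
  refine (mul_le_mul_of_nonneg_right (norm_sum_le _ _) (log_natCast_nonneg n)).trans ?_
  rw [Finset.sum_mul]
  refine Finset.sum_le_sum fun k hk => ?_
  rcases n.eq_zero_or_pos with rfl | hn
  · rw [Nat.cast_zero, log_zero, mul_zero]
    exact norm_delta_mul_log_nonneg c k
  · rw [delta, norm_sub_rev]
    gcongr
    exact (Finset.mem_Ico.1 hk).1

theorem exists_L1norm_sum_Ioc_le :
    ∃ C : ℝ, 0 < C ∧ ∀ (c : ℕ → ℂ) (n m : ℕ), 2 ≤ n → n ≤ m →
      L1norm (fun x => ∑ k ∈ Finset.Ioc n m, c k * expI k x) ≤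
        C * (‖c m‖ * log m + ‖c n‖ * log n + logVariation c n m) := by
  obtain ⟨C, hC, hexpSum⟩ := exists_L1norm_expSum_succ_le_log
  refine ⟨C, hC, fun c n m hn hnm => ?_⟩
  have hint : ∀ (b : ℂ) (k : ℕ), IntervalIntegrable (fun x => b * expSum k x) volume (-π) π :=
    fun b k => (by fun_prop : Continuous _).intervalIntegrable _ _
  have hterm : ∀ (b : ℂ) (k : ℕ), 2 ≤ k →
      L1norm (fun x => b * expSum (k + 1) x) ≤ C * (‖b‖ * log k) := fun b k hk => by
    rw [L1norm_const_mul, mul_left_comm]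
    gcongr
    exact hexpSum k hk
  simp only [sum_Ioc_mul_expI c hnm, logVariation, mul_add, Finset.mul_sum]
  refine (L1norm_add_le ((hint _ _).sub (hint _ _))
    ((by fun_prop : Continuous _).intervalIntegrable _ _)).trans (add_le_add ?_ ?_)
  · exact (L1norm_sub_le (hint _ _) (hint _ _)).trans
      (add_le_add (hterm _ _ (hn.trans hnm)) (hterm _ _ hn))
  · exact (L1norm_sum_le _ fun k _ => hint _ _).trans
      (Finset.sum_le_sum fun k hk => hterm _ _ (hn.trans (Finset.mem_Ico.1 hk).1))

theorem exists_L1norm_trigPoly_shell_le :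
    ∃ C : ℝ, 0 < C ∧ ∀ (a : ℤ → ℂ) (n m : ℕ), 2 ≤ n → n ≤ m →
      L1norm (trigPoly a (shell n m)) ≤
        C * ((‖a m‖ * log m + ‖a n‖ * log n + logVariation (fun k => a k) n m) +
          (‖a (-m)‖ * log m + ‖a (-n)‖ * log n + logVariation (fun k => a (-k)) n m)) := by
  obtain ⟨C, hC, hsum⟩ := exists_L1norm_sum_Ioc_le
  refine ⟨C, hC, fun a n m hn hnm => ?_⟩
  have hsplit : trigPoly a (shell n m) = fun x => ∑ k ∈ Finset.Ioc n m, a k * expI k x +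
      ∑ k ∈ Finset.Ioc n m, a (-k) * expI k (-x) := by
    ext x
    simp only [trigPoly, sum_shell, expI_apply_neg, Finset.sum_add_distrib]
  have hcont : ∀ c : ℕ → ℂ, Continuous fun x => ∑ k ∈ Finset.Ioc n m, c k * expI k x :=
    fun c => by fun_prop
  rw [hsplit, mul_add]
  refine (L1norm_add_le ((hcont fun k => a k).intervalIntegrable _ _)
    (((hcont fun k => a (-k)).comp continuous_neg).intervalIntegrable _ _)).trans
    (add_le_add (hsum (fun k => a k) n m hn hnm) ?_)
  exact (L1norm_comp_neg fun x => ∑ k ∈ Finset.Ioc n m, a (-k) * expI k x).trans_le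
    (hsum (fun k => a (-k)) n m hn hnm)

end LogVariation

section Fejer

/-- The Dirichlet kernel `∑_{|k| ≤ n} e^{ikx}`, whose convolution with a function is its `n`-th
partial sum. -/
noncomputable def dirichletKernel (n : ℕ) (x : ℝ) : ℂ :=
  ∑ k ∈ Finset.Icc (-(n : ℤ)) n, expI k x

@[fun_prop]
theorem continuous_dirichletKernel (n : ℕ) : Continuous (dirichletKernel n) :=
  continuous_finsetSum _ fun k _ => continuous_expI k

theorem periodic_dirichletKernel (n : ℕ) : Function.Periodic (dirichletKernel n) (2 * π) :=
  fun x => Finset.sum_congr rfl fun k _ => periodic_expI k x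

theorem integral_dirichletKernel (n : ℕ) :
    ∫ x in (-π)..π, dirichletKernel n x = 2 * π := by
  simp only [dirichletKernel]
  rw [intervalIntegral.integral_finsetSum fun k _ => (continuous_expI k).intervalIntegrable _ _]
  simp [integral_expI]

theorem expI_mul_expSum_neg (n : ℕ) (x : ℝ) :
    expI n x * expSum n (-x) = ∑ k ∈ Finset.Ioc 0 n, expI k x := by
  simp only [expSum, Finset.mul_sum, expI_apply_neg, ← expI_add]
  refine Finset.sum_nbij' (n - ·) (n - ·) ?_ ?_ ?_ ?_ fun k hk => ?_
  any_goals
    intro k hk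
    simp only [Finset.mem_range, Finset.mem_Ioc] at hk ⊢
    omega
  rw [← sub_eq_add_neg, Nat.cast_sub (Finset.mem_range.1 hk).le]

theorem dirichletKernel_eq (n : ℕ) (x : ℝ) :
    dirichletKernel n x = 1 + expI n x * expSum n (-x) + expI (-n) x * expSum n x := by
  have hneg := expI_mul_expSum_neg n (-x)
  rw [neg_neg, expI_apply_neg] at hneg
  have hsplit := Finset.sum_sdiff (f := fun k => expI k x)
    (Finset.Icc_subset_Icc (by omega) (by omega) : Finset.Icc (-(0 : ℕ) : ℤ) (0 : ℕ) ⊆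
      Finset.Icc (-(n : ℤ)) n)
  rw [expI_mul_expSum_neg, hneg, dirichletKernel, ← hsplit, ← shell, sum_shell]
  simp only [expI_apply_neg, Finset.sum_add_distrib, Nat.cast_zero, neg_zero, Finset.Icc_self,
    Finset.sum_singleton, expI_zero]
  ring

theorem sum_dirichletKernel (m : ℕ) (x : ℝ) :
    ∑ j ∈ Finset.range m, dirichletKernel j x = ((‖expSum m x‖ ^ 2 : ℝ) : ℂ) := by
  have hsq : ((‖expSum m x‖ ^ 2 : ℝ) : ℂ) = expSum m x * expSum m (-x) := by
    rw [← conj_expSum, Complex.mul_conj, Complex.normSq_eq_norm_sq]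
  rw [hsq]
  clear hsq
  induction m with
  | zero => simp [expSum]
  | succ m ih =>
    have hunit : expI m x * expI (-m) x = 1 := by rw [← expI_add, add_neg_cancel, expI_zero]
    rw [Finset.sum_range_succ, ih, dirichletKernel_eq, expSum_succ, expSum_succ, expI_apply_neg]
    linear_combination -hunit

/-- The Fejér kernel is nonnegative, so its norm is its integral. -/
theorem L1norm_sum_dirichletKernel (m : ℕ) :
    L1norm (fun x => ∑ j ∈ Finset.range m, dirichletKernel j x) = 2 * π * m := by
  have hpos : ∀ x, ((‖∑ j ∈ Finset.range m, dirichletKernel j x‖ : ℝ) : ℂ) =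
      ∑ j ∈ Finset.range m, dirichletKernel j x := fun x => by
    rw [sum_dirichletKernel, Complex.norm_real, norm_pow, norm_norm]
  rw [← Complex.ofReal_inj, L1norm, ← intervalIntegral.integral_ofReal]
  simp only [hpos]
  rw [intervalIntegral.integral_finsetSum fun j _ =>
    (continuous_dirichletKernel j).intervalIntegrable _ _]
  simp only [integral_dirichletKernel, Finset.sum_const, Finset.card_range, nsmul_eq_mul]
  push_cast
  ring

variable {f : ℝ → ℂ}

theorem intervalIntegrable_dirichletKernel_mul (hf : IntervalIntegrable f volume (-π) π)
    (n : ℕ) (x : ℝ) :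
    IntervalIntegrable (fun y => dirichletKernel n (x - y) * f y) volume (-π) π :=
  hf.continuousOn_mul (by fun_prop)

theorem partialSum_eq_integral (hf : IntervalIntegrable f volume (-π) π) (n : ℕ) (x : ℝ) :
    partialSum f n x = (2 * π : ℂ)⁻¹ * ∫ y in (-π)..π, dirichletKernel n (x - y) * f y := by
  simp only [dirichletKernel, Finset.sum_mul]
  rw [intervalIntegral.integral_finsetSum fun k _ => hf.continuousOn_mul (by fun_prop),
    Finset.mul_sum, partialSum_eq_trigPoly, trigPoly]
  refine Finset.sum_congr rfl fun k _ => ?_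
  simp only [expI_apply_sub, mul_assoc, fhat_eq_integral, intervalIntegral.integral_const_mul]
  ring

theorem L1norm_sum_partialSum_le (hf : IntervalIntegrable f volume (-π) π) (m : ℕ) :
    L1norm (fun x => ∑ j ∈ Finset.range m, partialSum f j x) ≤ m * L1norm f := by
  set F : ℝ → ℂ := fun x => ∑ j ∈ Finset.range m, dirichletKernel j x with hF
  have hconv : (fun x => ∑ j ∈ Finset.range m, partialSum f j x) =
      fun x => (2 * π : ℂ)⁻¹ * ∫ y in (-π)..π, F (x - y) * f y := by
    ext x
    simp only [hF, partialSum_eq_integral hf, Finset.sum_mul]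
    rw [intervalIntegral.integral_finsetSum fun j _ =>
      intervalIntegrable_dirichletKernel_mul hf j x, Finset.mul_sum]
  have hFper : Function.Periodic F (2 * π) := fun x =>
    Finset.sum_congr rfl fun j _ => periodic_dirichletKernel j x
  have hnorm : ‖(2 * π : ℂ)⁻¹‖ = (2 * π)⁻¹ := by simp [abs_of_pos pi_pos]
  rw [hconv, L1norm_const_mul, hnorm, inv_mul_le_iff₀ two_pi_pos, ← mul_assoc,
    ← L1norm_sum_dirichletKernel]
  exact L1norm_convolution_le (by fun_prop) hFper hf

theorem memLp_liftIoc [Fact (0 < 2 * π)] (hf : IntervalIntegrable f volume (-π) π) :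
    MemLp (AddCircle.liftIoc (2 * π) (-π) f) 1 AddCircle.haarAddCircle := by
  have hend : -π + 2 * π = π := by ring
  refine MemLp.haarAddCircle (MemLp.memLp_liftIoc ?_)
  rw [memLp_one_iff_integrable, hend]
  exact (intervalIntegrable_iff_integrableOn_Ioc_of_le (by linarith [pi_pos])).1 hf

theorem norm_toLp_liftIoc_sub_toLp [Fact (0 < 2 * π)]
    (hf : MemLp (AddCircle.liftIoc (2 * π) (-π) f) 1 AddCircle.haarAddCircle)
    (P : C(AddCircle (2 * π), ℂ)) :
    ‖hf.toLp - ContinuousMap.toLp 1 AddCircle.haarAddCircle ℂ P‖ =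
      (2 * π)⁻¹ * L1norm (fun x => f x - P x) := by
  have hle : -π ≤ π := by linarith [pi_pos]
  have hend : -π + 2 * π = π := by ring
  have hae : ∀ᵐ z ∂(AddCircle.haarAddCircle : Measure (AddCircle (2 * π))),
      ‖(hf.toLp - ContinuousMap.toLp 1 AddCircle.haarAddCircle ℂ P) z‖ =
        ‖AddCircle.liftIoc (2 * π) (-π) f z - P z‖ := by
    filter_upwards [Lp.coeFn_sub hf.toLp (ContinuousMap.toLp 1 AddCircle.haarAddCircle ℂ P),
      hf.coeFn_toLp, ContinuousMap.coeFn_toLp (𝕜 := ℂ) (p := 1) AddCircle.haarAddCircle P]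
      with z hsub hfz hPz
    rw [hsub, Pi.sub_apply, hfz, hPz]
  rw [L1.norm_eq_integral_norm, integral_congr_ae hae, AddCircle.integral_haarAddCircle,
    ← AddCircle.intervalIntegral_preimage _ (-π), hend, smul_eq_mul]
  congr 1
  simp only [L1norm, intervalIntegral.integral_of_le hle]
  refine setIntegral_congr_fun measurableSet_Ioc fun x hx => ?_
  rw [AddCircle.liftIoc_coe_apply (by rwa [hend])]

theorem exists_trigPoly_L1norm_sub_lt (hf : IntervalIntegrable f volume (-π) π)
    {ε : ℝ} (hε : 0 < ε) :
    ∃ (a : ℤ → ℂ) (s : Finset ℤ), L1norm (fun x => f x - trigPoly a s x) < ε := by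
  have hpi := two_pi_pos
  have : Fact (0 < 2 * π) := ⟨hpi⟩
  have hclosure : (memLp_liftIoc hf).toLp ∈
      (Submodule.span ℂ (Set.range (@fourierLp (2 * π) _ 1 _))).topologicalClosure := by
    rw [span_fourierLp_closure_eq_top ENNReal.one_ne_top]; trivial
  obtain ⟨g, hg, hdist⟩ := Metric.mem_closure_iff.1 hclosure ((2 * π)⁻¹ * ε) (by positivity)
  obtain ⟨a, rfl⟩ := Finsupp.mem_span_range_iff_exists_finsupp.1 hg
  have hsum : (a.sum fun k c => c • fourierLp 1 k) = ContinuousMap.toLp 1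
      AddCircle.haarAddCircle ℂ (∑ k ∈ a.support, a k • fourier (T := 2 * π) k) := by
    simp only [Finsupp.sum, map_sum, map_smul]
  rw [hsum, dist_eq_norm, norm_toLp_liftIoc_sub_toLp, mul_lt_mul_iff_right₀ (by positivity)]
    at hdist
  refine ⟨a, a.support, lt_of_eq_of_lt (congrArg L1norm (funext fun x => ?_)) hdist⟩
  simp [trigPoly, ← fourier_eq_expI rfl]

theorem eventually_partialSum_trigPoly_eq (a : ℤ → ℂ) (s : Finset ℤ) :
    ∀ᶠ n in atTop, partialSum (trigPoly a s) n = trigPoly a s := by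
  filter_upwards [eventually_ge_atTop (s.sup Int.natAbs)] with n hn
  refine partialSum_trigPoly a fun k hk => ?_
  have := (Finset.le_sup (f := Int.natAbs) hk).trans hn
  rw [Finset.mem_Icc]
  omega

theorem L1norm_sum_sub_partialSum_le {g : ℝ → ℂ} (hf : IntervalIntegrable f volume (-π) π)
    (hg : IntervalIntegrable g volume (-π) π) (m : ℕ) :
    L1norm (fun x => ∑ j ∈ Finset.range m, (f x - partialSum f j x)) ≤
      2 * m * L1norm (fun x => f x - g x) +
        ∑ j ∈ Finset.range m, L1norm (fun x => g x - partialSum g j x) := by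
  have hS : ∀ (u : ℝ → ℂ) (j : ℕ), IntervalIntegrable (partialSum u j) volume (-π) π :=
    fun u j => (continuous_partialSum u j).intervalIntegrable _ _
  have hsum : IntervalIntegrable
      (fun x => ∑ j ∈ Finset.range m, (g x - partialSum g j x)) volume (-π) π := by
    simpa only [Finset.sum_fn] using
      IntervalIntegrable.sum (Finset.range m) fun j _ => hg.sub (hS g j)
  set h : ℝ → ℂ := fun x => f x - g x with h_def
  have hh : IntervalIntegrable h volume (-π) π := hf.sub hg
  have hSh : IntervalIntegrable (fun x => ∑ j ∈ Finset.range m, partialSum h j x) volume (-π) π :=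
    (by fun_prop : Continuous _).intervalIntegrable _ _
  have hdecomp : (fun x => ∑ j ∈ Finset.range m, (f x - partialSum f j x)) = fun x =>
      ((m : ℂ) * h x - ∑ j ∈ Finset.range m, partialSum h j x) +
        ∑ j ∈ Finset.range m, (g x - partialSum g j x) := by
    ext x
    simp only [h_def, partialSum_sub hf hg, Finset.sum_sub_distrib, Finset.sum_const,
      Finset.card_range, nsmul_eq_mul]
    ring
  have hcontr := L1norm_sum_partialSum_le hh m
  have hmul : L1norm (fun x => (m : ℂ) * h x) = m * L1norm h := by
    rw [L1norm_const_mul, Complex.norm_natCast]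
  have htri := L1norm_add_le ((hh.const_mul (m : ℂ)).sub hSh) hsum
  have htri' := L1norm_sub_le (hh.const_mul (m : ℂ)) hSh
  rw [hdecomp]
  linarith [L1norm_sum_le (Finset.range m) fun j _ => hg.sub (hS g j)]

/-- Fejér's theorem in `L¹`: the Fejér means are uniformly bounded operators, and the statement is
clear for trigonometric polynomials. -/
theorem tendsto_L1norm_sum_sub_partialSum (hf : IntervalIntegrable f volume (-π) π) :
    Tendsto (fun m : ℕ => (m : ℝ)⁻¹ *
      L1norm (fun x => ∑ j ∈ Finset.range m, (f x - partialSum f j x))) atTop (𝓝 0) := by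
  refine Metric.tendsto_atTop'.2 fun ε hε => ?_
  obtain ⟨a, s, hP⟩ := exists_trigPoly_L1norm_sub_lt hf (ε := ε / 4) (by positivity)
  set P := trigPoly a s
  have hPdiff : Tendsto (fun j => L1norm (fun x => P x - partialSum P j x)) atTop (𝓝 0) := by
    refine tendsto_const_nhds.congr' ?_
    filter_upwards [eventually_partialSum_trigPoly_eq a s] with j hj
    simp [P, hj, L1norm]
  obtain ⟨N, hN⟩ := eventually_atTop.1 (hPdiff.cesaro.eventually_lt_const (half_pos hε))
  refine ⟨N, fun m hm => ?_⟩
  rw [Real.dist_0_eq_abs, abs_of_nonneg (mul_nonneg (by positivity) (L1norm_nonneg _))]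
  have hbound := L1norm_sum_sub_partialSum_le hf (intervalIntegrable_trigPoly a s) m
  have hmpos : (0 : ℝ) < m := by exact_mod_cast (Nat.zero_le N).trans_lt hm
  calc _ ≤ (m : ℝ)⁻¹ * (2 * m * L1norm (fun x => f x - P x) +
          ∑ j ∈ Finset.range m, L1norm (fun x => P x - partialSum P j x)) := by gcongr
    _ = 2 * L1norm (fun x => f x - P x) +
          (m : ℝ)⁻¹ * ∑ j ∈ Finset.range m, L1norm (fun x => P x - partialSum P j x) := by
        field_simp
    _ < ε := by linarith [hN m hm.le]

end Fejer

section SlowOscillation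

variable {f : ℝ → ℂ}

theorem eventually_le_floor_mul_sub {lam : ℝ} (hlam : 1 < lam) :
    ∀ᶠ n : ℕ in atTop, (lam - 1) / 2 * n ≤ ⌊lam * n⌋₊ - n := by
  filter_upwards [tendsto_natCast_atTop_atTop.eventually_ge_atTop (2 / (lam - 1))] with n hn
  rw [div_le_iff₀ (by linarith)] at hn
  linarith [Nat.lt_floor_add_one (lam * n)]

theorem natCast_le_floor_mul {lam : ℝ} (hlam : 1 ≤ lam) (n : ℕ) : n ≤ ⌊lam * n⌋₊ :=
  Nat.le_floor (le_mul_of_one_le_left n.cast_nonneg hlam)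

/-- De la Vallée Poussin's device of delayed means: average `f - S_n = (f - S_j) + (S_j - S_n)`
over `n ≤ j < m`. -/
theorem sub_mul_L1norm_sub_partialSum_le (hf : IntervalIntegrable f volume (-π) π) {n m : ℕ}
    (hnm : n ≤ m) :
    ((m : ℝ) - n) * L1norm (fun x => f x - partialSum f n x) ≤
      L1norm (fun x => ∑ j ∈ Finset.range m, (f x - partialSum f j x)) +
      L1norm (fun x => ∑ j ∈ Finset.range n, (f x - partialSum f j x)) +
        ∑ j ∈ Finset.Ico n m, L1norm (trigPoly (fhat f) (shell n j)) := by
  have hR : ∀ k, IntervalIntegrable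
      (fun x => ∑ j ∈ Finset.range k, (f x - partialSum f j x)) volume (-π) π := fun k => by
    simpa only [Finset.sum_fn] using IntervalIntegrable.sum (Finset.range k) fun j _ =>
      hf.sub ((continuous_partialSum f j).intervalIntegrable _ _)
  have hT : IntervalIntegrable
      (fun x => ∑ j ∈ Finset.Ico n m, trigPoly (fhat f) (shell n j) x) volume (-π) π :=
    (by fun_prop : Continuous _).intervalIntegrable _ _
  have hdecomp : (fun x => ((m - n : ℝ) : ℂ) * (f x - partialSum f n x)) = fun x =>
      (∑ j ∈ Finset.range m, (f x - partialSum f j x) -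
        ∑ j ∈ Finset.range n, (f x - partialSum f j x)) +
          ∑ j ∈ Finset.Ico n m, trigPoly (fhat f) (shell n j) x := by
    ext x
    have hterm : ∀ j ∈ Finset.Ico n m, f x - partialSum f j x =
        f x - partialSum f n x - trigPoly (fhat f) (shell n j) x := fun j hj => by
      rw [← partialSum_sub_partialSum f (Finset.mem_Ico.1 hj).1]; ring
    rw [← Finset.sum_Ico_eq_sub _ hnm, Finset.sum_congr rfl hterm, Finset.sum_sub_distrib,
      Finset.sum_const, Nat.card_Ico, nsmul_eq_mul, Nat.cast_sub hnm]
    push_cast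
    ring
  have hnorm : ((m : ℝ) - n) * L1norm (fun x => f x - partialSum f n x) =
      L1norm (fun x => ((m - n : ℝ) : ℂ) * (f x - partialSum f n x)) := by
    rw [L1norm_const_mul, Complex.norm_real,
      Real.norm_of_nonneg (sub_nonneg.2 (Nat.cast_le.2 hnm))]
  rw [hnorm, hdecomp]
  exact (L1norm_add_le ((hR m).sub (hR n)) hT).trans (add_le_add (L1norm_sub_le (hR m) (hR n))
    (L1norm_sum_le _ fun j _ => intervalIntegrable_trigPoly _ _))

/-- A Tauberian theorem: Cesàro convergence, which holds by Fejér's theorem, and slow oscillation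
imply convergence. -/
theorem tendsto_L1norm_sub_partialSum (hf : IntervalIntegrable f volume (-π) π)
    (hosc : ∀ ε > 0, ∃ lam : ℝ, 1 < lam ∧ ∀ᶠ n : ℕ in atTop, ∀ j, n ≤ j → j ≤ ⌊lam * n⌋₊ →
      L1norm (trigPoly (fhat f) (shell n j)) ≤ ε) :
    Tendsto (fun n => L1norm (fun x => f x - partialSum f n x)) atTop (𝓝 0) := by
  refine Metric.tendsto_nhds.2 fun ε hε => ?_
  obtain ⟨lam, hlam, hosc⟩ := hosc (ε / 4) (by positivity)
  have : 0 < lam - 1 := sub_pos.2 hlam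
  set δ := ε / 4 * ((lam - 1) / 2) / (lam + 1)
  have hδ' : δ * (lam + 1) = ε / 4 * ((lam - 1) / 2) := div_mul_cancel₀ _ (by linarith)
  have hmean : ∀ᶠ m : ℕ in atTop,
      L1norm (fun x => ∑ j ∈ Finset.range m, (f x - partialSum f j x)) ≤ δ * m := by
    filter_upwards [(tendsto_L1norm_sum_sub_partialSum hf).eventually_le_const (u := δ)
      (by positivity), eventually_gt_atTop 0] with m hm hpos
    rwa [inv_mul_le_iff₀ (by exact_mod_cast hpos), mul_comm] at hm
  filter_upwards [hosc, eventually_forall_ge_atTop.2 hmean, eventually_le_floor_mul_sub hlam,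
    eventually_gt_atTop 0] with n hosc hmean hgap hn
  rw [Real.dist_0_eq_abs, abs_of_nonneg (L1norm_nonneg _)]
  set m := ⌊lam * n⌋₊
  have hnm : n ≤ m := natCast_le_floor_mul hlam.le n
  have : (0 : ℝ) < n := by exact_mod_cast hn
  have hm_le : (m : ℝ) ≤ lam * n := Nat.floor_le (by positivity)
  have hgap_pos : 0 < (m : ℝ) - n := (by positivity : 0 < (lam - 1) / 2 * n).trans_le hgap
  have hblock : ∑ j ∈ Finset.Ico n m, L1norm (trigPoly (fhat f) (shell n j)) ≤
      ((m : ℝ) - n) * (ε / 4) := by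
    rw [← Nat.cast_sub hnm, ← Nat.card_Ico, ← nsmul_eq_mul]
    exact Finset.sum_le_card_nsmul _ _ _ fun j hj =>
      hosc j (Finset.mem_Ico.1 hj).1 (Finset.mem_Ico.1 hj).2.le
  have hmeans : δ * m + δ * n ≤ ((m : ℝ) - n) * (ε / 4) :=
    calc δ * m + δ * n ≤ δ * (lam * n) + δ * n := by gcongr
      _ = (lam - 1) / 2 * n * (ε / 4) := by linear_combination n * hδ'
      _ ≤ ((m : ℝ) - n) * (ε / 4) := by gcongr
  refine lt_of_mul_lt_mul_left ?_ hgap_pos.le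
  linarith [sub_mul_L1norm_sub_partialSum_le hf hnm, hmean m hnm, hmean n le_rfl,
    mul_pos hgap_pos hε]

end SlowOscillation

section HarmonicWeights

variable {n m : ℕ}

theorem log_sub_add_one_le_sum_inv (hnm : n ≤ m) :
    log ((m : ℝ) - n + 1) ≤ ∑ k ∈ Finset.Ioc n m, ((k : ℝ) - n)⁻¹ := by
  have hharmonic : ∑ k ∈ Finset.Ioc n m, ((k : ℝ) - n)⁻¹ = (harmonic (m - n) : ℚ) := by
    induction m, hnm using Nat.le_induction with
    | base => simp
    | succ m hm ih =>
      rw [Finset.sum_Ioc_succ_top (by omega), ih, Nat.succ_sub hm, harmonic_succ]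
      push_cast [Nat.cast_sub hm]
      ring
  rw [hharmonic, ← Nat.cast_sub hnm]
  exact_mod_cast log_add_one_le_harmonic (m - n)

theorem log_le_two_mul_sum_inv (hnm : n ≤ m) {x : ℝ} (hx : 0 < x)
    (hxm : x ≤ ((m : ℝ) - n + 1) ^ 2) :
    log x ≤ 2 * ∑ k ∈ Finset.Ioc n m, ((k : ℝ) - n)⁻¹ :=
  calc log x ≤ log (((m : ℝ) - n + 1) ^ 2) := log_le_log hx hxm
    _ = 2 * log ((m : ℝ) - n + 1) := by rw [log_pow, Nat.cast_two]
    _ ≤ _ := by gcongr; exact log_sub_add_one_le_sum_inv hnm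

theorem inv_sub_nonneg_of_mem_Ioc {k : ℕ} (hk : k ∈ Finset.Ioc n m) : 0 ≤ ((k : ℝ) - n)⁻¹ :=
  inv_nonneg.2 (sub_nonneg.2 (Nat.cast_le.2 (Finset.mem_Ioc.1 hk).1.le))

theorem sum_shift_mul_inv_le {u : ℕ → ℝ} (hu : 0 ≤ u) {i M : ℕ} (hM : m + i ≤ M) :
    ∑ k ∈ Finset.Ioc n m, u (k + i) * ((k : ℝ) - n)⁻¹ ≤
      (i + 1) * ∑ k ∈ Finset.Ioc n M, u k * ((k : ℝ) - n)⁻¹ := by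
  have hterm : ∀ k ∈ Finset.Ioc n m,
      u (k + i) * ((k : ℝ) - n)⁻¹ ≤ (i + 1) * (u (k + i) * (((k + i : ℕ) : ℝ) - n)⁻¹) := by
    intro k hk
    have hk : (1 : ℝ) ≤ k - n := by
      rw [le_sub_iff_add_le']; exact_mod_cast (Finset.mem_Ioc.1 hk).1
    have : (0 : ℝ) ≤ i := i.cast_nonneg
    rw [mul_left_comm]
    refine mul_le_mul_of_nonneg_left ?_ (hu _)
    rw [← div_eq_mul_inv, inv_eq_one_div, div_le_div_iff₀ (by linarith) (by push_cast; linarith)]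
    push_cast
    nlinarith
  refine (Finset.sum_le_sum hterm).trans ?_
  have hshift : ∑ k ∈ Finset.Ioc n m, u (k + i) * (((k + i : ℕ) : ℝ) - n)⁻¹ =
      ∑ k ∈ Finset.Ioc (n + i) (m + i), u k * ((k : ℝ) - n)⁻¹ := by
    rw [← Finset.map_add_right_Ioc, Finset.sum_map]; rfl
  rw [← Finset.mul_sum, hshift]
  exact mul_le_mul_of_nonneg_left (Finset.sum_le_sum_of_subset_of_nonneg
    (Finset.Ioc_subset_Ioc (Nat.le_add_right n i) hM) fun k hk _ =>
      mul_nonneg (hu k) (inv_sub_nonneg_of_mem_Ioc hk)) (by positivity)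

end HarmonicWeights

section GBV

variable {c : ℕ → ℂ}

theorem cos_mul_norm_le_re {θ : ℝ} (hθ : θ ≤ π) {z : ℂ} (hz : z ∈ sector θ) :
    cos θ * ‖z‖ ≤ z.re := by
  rw [← Complex.norm_mul_cos_arg z, mul_comm, ← cos_abs (Complex.arg z)]
  exact mul_le_mul_of_nonneg_left (cos_le_cos_of_nonneg_of_le_pi (abs_nonneg _) hθ hz)
    (norm_nonneg _)

theorem GBV.exists_sum_norm_delta_le (hc : GBV c) :
    ∃ (N : ℕ) (M : ℝ), 0 < N ∧ 0 < M ∧ ∀ m, 1 ≤ m →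
      ∑ k ∈ Finset.Icc m (2 * m), ‖delta c k‖ ≤ M * ∑ i ∈ Finset.range N, ‖c (m + i)‖ := by
  obtain ⟨-, N, hN, M, hM, h⟩ := hc
  refine ⟨N, M, hN, hM, fun m hm => (h m hm).trans ?_⟩
  refine mul_le_mul_of_nonneg_left (Finset.sup'_le _ _ fun k hk => ?_) hM.le
  simpa only [Finset.sum_Ico_eq_sum_range, Nat.add_sub_cancel_left] using
    Finset.single_le_sum (f := fun k => ‖c k‖) (fun _ _ => norm_nonneg _) hk

theorem GBV.exists_norm_le_sum (hc : GBV c) :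
    ∃ (N : ℕ) (B : ℝ), 0 < B ∧ ∀ k p, 1 ≤ k → k ≤ p → p ≤ 2 * k →
      ‖c p‖ ≤ B * ∑ i ∈ Finset.range N, ‖c (k + i)‖ := by
  obtain ⟨N, M, hN, hM, hdelta⟩ := hc.exists_sum_norm_delta_le
  refine ⟨N, M + 1, by positivity, fun k p hk hkp hpk => ?_⟩
  have hfirst : ‖c k‖ ≤ ∑ i ∈ Finset.range N, ‖c (k + i)‖ :=
    Finset.single_le_sum (f := fun i => ‖c (k + i)‖) (fun _ _ => norm_nonneg _)
      (Finset.mem_range.2 hN)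
  calc ‖c p‖ ≤ ‖c p - c k‖ + ‖c k‖ := by simpa using norm_add_le (c p - c k) (c k)
    _ ≤ ∑ j ∈ Finset.Ico k p, ‖delta c j‖ + ‖c k‖ := by
        rw [← Finset.sum_Ico_sub c hkp]
        gcongr
        exact norm_sum_le_of_le _ fun j _ => (norm_sub_rev _ _).le
    _ ≤ ∑ j ∈ Finset.Icc k (2 * k), ‖delta c j‖ + ‖c k‖ := by
        gcongr
        exact Finset.Ico_subset_Icc_self.trans (Finset.Icc_subset_Icc_right hpk)
    _ ≤ (M + 1) * ∑ i ∈ Finset.range N, ‖c (k + i)‖ := by linarith [hdelta k hk]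

theorem GBV.tendsto_logVariation (hc : GBV c)
    (hlog : Tendsto (fun n : ℕ => ‖c n‖ * log n) atTop (𝓝 0)) :
    Tendsto (fun n => logVariation c n (2 * n + 1)) atTop (𝓝 0) := by
  obtain ⟨N, M, -, hM, hdelta⟩ := hc.exists_sum_norm_delta_le
  have hbound : Tendsto (fun n : ℕ => 2 * M * ∑ i ∈ Finset.range N,
      ‖c (n + i)‖ * log ((n + i : ℕ) : ℝ)) atTop (𝓝 0) := by
    simpa using (tendsto_finsetSum (Finset.range N) fun i _ =>
      hlog.comp (tendsto_add_atTop_nat i)).const_mul (2 * M)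
  refine squeeze_zero' (.of_forall fun n => logVariation_nonneg c n _) ?_ hbound
  filter_upwards [eventually_ge_atTop 2] with n hn
  have : (0 : ℝ) < n := by exact_mod_cast (by omega : 0 < n)
  have hlog_le : ∀ k ∈ Finset.Icc n (2 * n), log k ≤ 2 * log n := fun k hk => by
    rw [Finset.mem_Icc] at hk
    rw [← Nat.cast_two, ← log_pow]
    exact log_le_log (by exact_mod_cast (by omega : 0 < k))
      (by exact_mod_cast (by nlinarith : k ≤ n ^ 2))
  calc logVariation c n (2 * n + 1) = ∑ k ∈ Finset.Icc n (2 * n), ‖delta c k‖ * log k := rfl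
    _ ≤ ∑ k ∈ Finset.Icc n (2 * n), ‖delta c k‖ * (2 * log n) := by
        gcongr with k hk
        exact hlog_le k hk
    _ ≤ M * ∑ i ∈ Finset.range N, ‖c (n + i)‖ * (2 * log n) := by
        rw [← Finset.sum_mul _ _ (2 * log n), ← Finset.sum_mul _ _ (2 * log n)]
        exact (mul_le_mul_of_nonneg_right (hdelta n (by omega))
          (mul_nonneg zero_le_two (log_natCast_nonneg n))).trans_eq (mul_assoc _ _ _)
    _ = 2 * M * ∑ i ∈ Finset.range N, ‖c (n + i)‖ * log n := by
        simp only [mul_left_comm _ (2 : ℝ), ← Finset.mul_sum]; ring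
    _ ≤ 2 * M * ∑ i ∈ Finset.range N, ‖c (n + i)‖ * log ((n + i : ℕ) : ℝ) := by
        gcongr
        omega

/-- Averaging `‖c p‖ ≤ B ∑ i, ‖c (k + i)‖` over `k` with the weights `1 / (k - n)`, whose total
mass is of order `log p`, produces the logarithm. -/
theorem GBV.exists_norm_mul_log_le (hc : GBV c) :
    ∃ K : ℝ, ∀ᶠ n : ℕ in atTop, ∀ p, 2 * n ≤ p → p ≤ 2 * n + 1 →
      ‖c p‖ * log p ≤ K * ∑ k ∈ Finset.Ioc n (2 * n), ‖c k‖ * ((k : ℝ) - n)⁻¹ := by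
  obtain ⟨N, B, hB, hc⟩ := hc.exists_norm_le_sum
  refine ⟨2 * (B * (N * N)), ?_⟩
  filter_upwards [eventually_ge_atTop (2 * N + 5)] with n hn p hnp hpn
  set m := 2 * n - N
  have hlog : log p ≤ 2 * ∑ k ∈ Finset.Ioc n m, ((k : ℝ) - n)⁻¹ := by
    refine log_le_two_mul_sum_inv (by omega) (by exact_mod_cast (by omega : 0 < p)) ?_
    have : p ≤ 4 * (m - n) + 1 ∧ 4 ≤ m - n := by omega
    rw [← Nat.cast_sub (by omega)]
    exact_mod_cast (by nlinarith : p ≤ (m - n + 1) ^ 2)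
  have hsum : ‖c p‖ * ∑ k ∈ Finset.Ioc n m, ((k : ℝ) - n)⁻¹ ≤
      B * (N * (N * ∑ k ∈ Finset.Ioc n (2 * n), ‖c k‖ * ((k : ℝ) - n)⁻¹)) := by
    calc ‖c p‖ * ∑ k ∈ Finset.Ioc n m, ((k : ℝ) - n)⁻¹
        ≤ ∑ k ∈ Finset.Ioc n m, (B * ∑ i ∈ Finset.range N, ‖c (k + i)‖) * ((k : ℝ) - n)⁻¹ := by
          rw [Finset.mul_sum]
          refine Finset.sum_le_sum fun k hk => mul_le_mul_of_nonneg_right ?_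
            (inv_sub_nonneg_of_mem_Ioc hk)
          rw [Finset.mem_Ioc] at hk
          exact hc k p (by omega) (by omega) (by omega)
      _ = B * ∑ i ∈ Finset.range N, ∑ k ∈ Finset.Ioc n m, ‖c (k + i)‖ * ((k : ℝ) - n)⁻¹ := by
          rw [Finset.sum_comm, Finset.mul_sum]
          exact Finset.sum_congr rfl fun k _ => by rw [mul_assoc, Finset.sum_mul]
      _ ≤ B * ∑ _i ∈ Finset.range N,
            (N * ∑ k ∈ Finset.Ioc n (2 * n), ‖c k‖ * ((k : ℝ) - n)⁻¹) := by
          gcongr with _ hi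
          rw [Finset.mem_range] at hi
          refine (sum_shift_mul_inv_le (u := fun k => ‖c k‖) (fun _ => norm_nonneg _)
            (M := 2 * n) (by omega)).trans ?_
          gcongr
          · exact Finset.sum_nonneg fun k hk =>
              mul_nonneg (norm_nonneg _) (inv_sub_nonneg_of_mem_Ioc hk)
          · exact_mod_cast hi
      _ = _ := by rw [Finset.sum_const, Finset.card_range, nsmul_eq_mul]
  calc ‖c p‖ * log p ≤ ‖c p‖ * (2 * ∑ k ∈ Finset.Ioc n m, ((k : ℝ) - n)⁻¹) := by gcongr
    _ ≤ _ := by linarith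

end GBV

section CauchyL1

variable {a : ℤ → ℂ}

/-- The symmetric partial sums of the trigonometric series with coefficients `a` form a Cauchy
sequence in `L¹`. -/
def CauchyL1 (a : ℤ → ℂ) : Prop :=
  ∀ ε > 0, ∀ᶠ n : ℕ in atTop, ∀ m, n ≤ m → L1norm (trigPoly a (shell n m)) ≤ ε

theorem cauchyL1_fhat {f : ℝ → ℂ} (hf : IntervalIntegrable f volume (-π) π)
    (hlim : Tendsto (fun n => L1norm (fun x => f x - partialSum f n x)) atTop (𝓝 0)) :
    CauchyL1 (fhat f) := fun ε hε => by
  have hint : ∀ n, IntervalIntegrable (fun x => f x - partialSum f n x) volume (-π) π := fun n =>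
    hf.sub ((continuous_partialSum f n).intervalIntegrable _ _)
  filter_upwards [eventually_forall_ge_atTop.2 (hlim.eventually_le_const (half_pos hε))]
    with n hn m hnm
  have hshell : trigPoly (fhat f) (shell n m) = fun x =>
      (f x - partialSum f n x) - (f x - partialSum f m x) := by
    ext x
    rw [sub_sub_sub_cancel_left, partialSum_sub_partialSum f hnm]
  rw [hshell]
  linarith [L1norm_sub_le (hint n) (hint m), hn n le_rfl, hn m hnm]

theorem CauchyL1.reflect (h : CauchyL1 a) : CauchyL1 fun k => a (-k) := by
  simpa only [CauchyL1, L1norm_trigPoly_shell_neg] using h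

theorem CauchyL1.tendsto_coeff (h : CauchyL1 a) : Tendsto (fun n : ℕ => a n) atTop (𝓝 0) := by
  refine (tendsto_add_atTop_iff_nat 1).1 (Metric.tendsto_nhds.2 fun ε hε => ?_)
  filter_upwards [h ε hε] with n hn
  have hmem : ((n + 1 : ℕ) : ℤ) ∈ shell n (n + 1) := by rw [mem_shell]; omega
  rw [dist_zero_right]
  calc ‖a (n + 1 : ℕ)‖ ≤ (2 * π)⁻¹ * L1norm (trigPoly a (shell n (n + 1))) :=
        norm_coeff_le_L1norm_trigPoly a hmem
    _ ≤ (2 * π)⁻¹ * ε := by gcongr; exact hn (n + 1) n.le_succ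
    _ < ε := mul_lt_of_lt_one_left hε (inv_lt_one_of_one_lt₀ (by linarith [pi_gt_three]))

theorem norm_sum_Ioc_div_sub_le (a : ℤ → ℂ) (n m : ℕ) :
    ‖∑ k ∈ Finset.Ioc n m, a k / ((k : ℂ) - n)‖ ≤
      1 / 2 * L1norm (trigPoly a (shell n m)) +
        ∑ k ∈ Finset.Ioc n m, ‖a (-k)‖ / ((k : ℝ) + n) := by
  have hmem : (n : ℤ) ∉ shell n m := by rw [mem_shell]; omega
  have hsplit : ∑ k ∈ Finset.Ioc n m, a k / ((k : ℂ) - n) =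
      ∑ k ∈ shell n m, a k / ((k : ℂ) - (n : ℤ)) +
        ∑ k ∈ Finset.Ioc n m, a (-k) / ((k + n : ℕ) : ℂ) := by
    rw [sum_shell, ← Finset.sum_add_distrib]
    refine Finset.sum_congr rfl fun k _ => ?_
    push_cast
    rw [← neg_add', div_neg, add_assoc, neg_add_cancel, add_zero]
  rw [hsplit]
  refine (norm_add_le _ _).trans (add_le_add (norm_sum_div_sub_le_L1norm a hmem)
    (norm_sum_le_of_le _ fun k _ => ?_))
  rw [norm_div, Complex.norm_natCast, Nat.cast_add]

theorem CauchyL1.eventually_norm_sum_Ioc_div_sub_le (h : CauchyL1 a) {ε : ℝ} (hε : 0 < ε) :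
    ∀ᶠ n : ℕ in atTop, ∀ m, n ≤ m → m ≤ 2 * n →
      ‖∑ k ∈ Finset.Ioc n m, a k / ((k : ℂ) - n)‖ ≤ ε := by
  have hcoeff : ∀ᶠ n : ℕ in atTop, ‖a (-n)‖ ≤ ε / 2 :=
    (tendsto_zero_iff_norm_tendsto_zero.1 h.reflect.tendsto_coeff).eventually_le_const
      (half_pos hε)
  filter_upwards [h ε hε, eventually_forall_ge_atTop.2 hcoeff, eventually_gt_atTop 0]
    with n hshell hcoeff hn m hnm hm
  have hreflected : ∑ k ∈ Finset.Ioc n m, ‖a (-k)‖ / ((k : ℝ) + n) ≤ ε / 2 :=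
    calc ∑ k ∈ Finset.Ioc n m, ‖a (-k)‖ / ((k : ℝ) + n)
        ≤ ∑ k ∈ Finset.Ioc n m, ε / 2 / n := by
          gcongr with k hk
          · exact hcoeff k (Finset.mem_Ioc.1 hk).1.le
          · exact le_add_of_nonneg_left k.cast_nonneg
      _ = ((m - n : ℕ) : ℝ) * (ε / 2 / n) := by
          rw [Finset.sum_const, Nat.card_Ioc, nsmul_eq_mul]
      _ ≤ n * (ε / 2 / n) := by gcongr; omega
      _ = ε / 2 := by field_simp
  linarith [norm_sum_Ioc_div_sub_le a n m, hshell m hnm]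

theorem CauchyL1.tendsto_sum_Ioc_div_sub (h : CauchyL1 a) :
    Tendsto (fun n : ℕ => ∑ k ∈ Finset.Ioc n (2 * n), a k / ((k : ℂ) - n)) atTop (𝓝 0) := by
  refine Metric.tendsto_nhds.2 fun ε hε => ?_
  filter_upwards [h.eventually_norm_sum_Ioc_div_sub_le (half_pos hε)] with n hn
  rw [dist_zero_right]
  exact (hn (2 * n) (by omega) le_rfl).trans_lt (half_lt_self hε)

end CauchyL1

section Necessity

variable {c : ℕ → ℂ} {n m : ℕ}

theorem norm_div_natCast_sub (z : ℂ) {k : ℕ} (hk : k ∈ Finset.Ioc n m) :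
    ‖z / ((k : ℂ) - n)‖ = ‖z‖ * ((k : ℝ) - n)⁻¹ := by
  rw [← norm_of_nonneg (inv_sub_nonneg_of_mem_Ioc hk), ← Complex.norm_real, ← norm_mul]
  push_cast
  rw [div_eq_mul_inv]

theorem cos_mul_sum_norm_le {θ : ℝ} (hθ : θ ≤ π) (hc : ∀ k, 1 ≤ k → c k ∈ sector θ) (n m : ℕ) :
    cos θ * ∑ k ∈ Finset.Ioc n m, ‖c k‖ * ((k : ℝ) - n)⁻¹ ≤
      ‖∑ k ∈ Finset.Ioc n m, c k / ((k : ℂ) - n)‖ := by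
  refine le_trans ?_ (Complex.re_le_norm _)
  rw [Finset.mul_sum, Complex.re_sum]
  refine Finset.sum_le_sum fun k hk => ?_
  have hdiv : c k / ((k : ℂ) - n) = c k * (((k : ℝ) - n)⁻¹ : ℝ) := by
    push_cast; rw [div_eq_mul_inv]
  rw [hdiv, Complex.re_mul_ofReal, ← mul_assoc]
  exact mul_le_mul_of_nonneg_right
    (cos_mul_norm_le_re hθ (hc k (Nat.one_le_of_lt (Finset.mem_Ioc.1 hk).1)))
    (inv_sub_nonneg_of_mem_Ioc hk)

theorem GBV.tendsto_norm_mul_log (hc : GBV c)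
    (hsum : Tendsto (fun n : ℕ => ∑ k ∈ Finset.Ioc n (2 * n), c k / ((k : ℂ) - n)) atTop (𝓝 0)) :
    Tendsto (fun n : ℕ => ‖c n‖ * log n) atTop (𝓝 0) := by
  obtain ⟨K, hK⟩ := hc.exists_norm_mul_log_le
  obtain ⟨⟨θ, hθ₀, hθ, hsector⟩, -⟩ := hc
  have hcos : 0 < cos θ := cos_pos_of_mem_Ioo ⟨by linarith [pi_pos], hθ⟩
  have hweighted : Tendsto (fun n : ℕ => ∑ k ∈ Finset.Ioc n (2 * n), ‖c k‖ * ((k : ℝ) - n)⁻¹)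
      atTop (𝓝 0) := by
    refine squeeze_zero (fun n => Finset.sum_nonneg fun k hk =>
      mul_nonneg (norm_nonneg _) (inv_sub_nonneg_of_mem_Ioc hk)) (fun n => ?_)
      (by simpa using hsum.norm.const_mul (cos θ)⁻¹)
    exact (le_inv_mul_iff₀ hcos).2 (cos_mul_sum_norm_le (by linarith [pi_pos]) hsector n _)
  have hhalf : Tendsto (fun p : ℕ => p / 2) atTop atTop := Nat.tendsto_div_const_atTop two_ne_zero
  refine squeeze_zero' (.of_forall fun n => mul_nonneg (norm_nonneg _) (log_natCast_nonneg n)) ?_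
    (by simpa using (hweighted.comp hhalf).const_mul K)
  filter_upwards [hhalf.eventually hK] with p hp
  exact hp p (by omega) (by omega)

/-- In `∑ g k / (k - n)` replace `g k` by `g n`: the weights `1 / (k - n)` then contribute at least
`log n / 2`, while the error is governed by the variation of `g`. -/
theorem norm_mul_log_le (g : ℕ → ℂ) (hn : 0 < n) (hnm : n ≤ m)
    (hm : (n : ℝ) ≤ ((m : ℝ) - n + 1) ^ 2) :
    ‖g n‖ * log n ≤
      2 * ‖∑ k ∈ Finset.Ioc n m, g k / ((k : ℂ) - n)‖ + logVariation g n m := by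
  set S := ∑ k ∈ Finset.Ioc n m, g k / ((k : ℂ) - n)
  set H := ∑ k ∈ Finset.Ioc n m, ((k : ℝ) - n)⁻¹ with hH
  set V := logVariation g n m
  have hV : 0 ≤ V := logVariation_nonneg g n m
  have hlogH : log n ≤ 2 * H := log_le_two_mul_sum_inv hnm (by exact_mod_cast hn) hm
  have hlog : 0 ≤ log n := log_natCast_nonneg n
  have hH0 : 0 ≤ H := by linarith
  rcases hH0.eq_or_lt with hzero | hHpos
  · rw [show log n = 0 by linarith, mul_zero]
    positivity
  have herror : ‖∑ k ∈ Finset.Ioc n m, (g k - g n) / ((k : ℂ) - n)‖ * log n ≤ V * H := by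
    refine (mul_le_mul_of_nonneg_right (norm_sum_le _ _) hlog).trans ?_
    rw [Finset.sum_mul, hH, Finset.mul_sum]
    refine Finset.sum_le_sum fun k hk => ?_
    rw [norm_div_natCast_sub _ hk, mul_right_comm]
    refine mul_le_mul_of_nonneg_right ?_ (inv_sub_nonneg_of_mem_Ioc hk)
    rw [Finset.mem_Ioc] at hk
    exact (norm_sub_mul_log_le_logVariation g hk.1.le).trans (logVariation_mono g n hk.2)
  have hsplit : g n * H = S - ∑ k ∈ Finset.Ioc n m, (g k - g n) / ((k : ℂ) - n) := by
    rw [← Finset.sum_sub_distrib, hH]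
    push_cast
    rw [Finset.mul_sum]
    exact Finset.sum_congr rfl fun k _ => by ring
  refine le_of_mul_le_mul_right ?_ hHpos
  calc ‖g n‖ * log n * H = ‖g n * H‖ * log n := by
        rw [norm_mul, Complex.norm_real, norm_of_nonneg hH0, mul_right_comm]
    _ ≤ ‖S‖ * log n + V * H := by
        rw [hsplit]
        refine (mul_le_mul_of_nonneg_right (norm_sub_le _ _) hlog).trans ?_
        rw [add_mul]
        gcongr
    _ ≤ ‖S‖ * (2 * H) + V * H := by gcongr
    _ = (2 * ‖S‖ + V) * H := by ring

end Necessity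

section Balance

variable {a : ℤ → ℂ}

/-- The sequence `n ↦ a_n - a_{-n}`, whose variation enters the balance condition. -/
def asymmetry (a : ℤ → ℂ) : ℕ → ℂ := fun n => a n - a (-n)

/-- The balance condition `lim_{λ → 1⁺} limsup_n ∑_{k=n}^{[λn]} |Δa_k - Δa_{-k}| log k = 0` in
`ε`-form. The bound `λ < 2` keeps the blocks dyadic. -/
def Balanced (a : ℤ → ℂ) : Prop :=
  ∀ ε > 0, ∃ lam : ℝ, 1 < lam ∧ lam < 2 ∧
    ∀ᶠ n : ℕ in atTop, logVariation (asymmetry a) n (⌊lam * n⌋₊ + 1) ≤ ε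

theorem balanceSum_eq_logVariation (f : ℝ → ℂ) (lam : ℝ) (n : ℕ) :
    balanceSum f lam n = logVariation (asymmetry (fhat f)) n (⌊lam * n⌋₊ + 1) := by
  change _ = logVariation ((fun k : ℕ => fhat f k) - fun k : ℕ => fhat f (-k)) n _
  rw [logVariation, delta_sub]
  rfl

theorem balanced_fhat {f : ℝ → ℂ}
    (hbal : Tendsto (fun lam : ℝ => limsup (fun n : ℕ => ((balanceSum f lam n : ℝ) : EReal)) atTop)
      (𝓝[>] (1 : ℝ)) (𝓝 (0 : EReal))) :
    Balanced (fhat f) := fun ε hε => by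
  obtain ⟨lam, hlimsup, hlam⟩ := ((hbal.eventually_lt_const (EReal.coe_pos.2 hε)).and
    (Ioo_mem_nhdsGT one_lt_two)).exists
  refine ⟨lam, hlam.1, hlam.2, ?_⟩
  filter_upwards [eventually_lt_of_limsup_lt hlimsup] with n hn
  rw [← balanceSum_eq_logVariation]
  exact (EReal.coe_lt_coe_iff.1 hn).le

theorem floor_mul_le_two_mul {lam : ℝ} (hlam : lam ≤ 2) (n : ℕ) : ⌊lam * n⌋₊ ≤ 2 * n :=
  Nat.floor_le_of_le (by push_cast; gcongr)

theorem eventually_natCast_le_sq {δ : ℝ} (hδ : 0 < δ) :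
    ∀ᶠ n : ℕ in atTop, (n : ℝ) ≤ (δ * n) ^ 2 := by
  filter_upwards [tendsto_natCast_atTop_atTop.eventually_ge_atTop (1 / δ ^ 2)] with n hn
  rw [div_le_iff₀ (by positivity)] at hn
  nlinarith [(n.cast_nonneg : (0 : ℝ) ≤ n)]

theorem Balanced.tendsto_norm_asymmetry_mul_log (hb : Balanced a) (ha : CauchyL1 a) :
    Tendsto (fun n : ℕ => ‖asymmetry a n‖ * log n) atTop (𝓝 0) := by
  refine Metric.tendsto_nhds.2 fun ε hε => ?_
  obtain ⟨lam, hlam, hlam', hvar⟩ := hb (ε / 6) (by positivity)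
  filter_upwards [hvar, ha.eventually_norm_sum_Ioc_div_sub_le (by positivity : 0 < ε / 6),
    ha.reflect.eventually_norm_sum_Ioc_div_sub_le (by positivity : 0 < ε / 6),
    eventually_le_floor_mul_sub hlam, eventually_natCast_le_sq (half_pos (sub_pos.2 hlam)),
    eventually_gt_atTop 0] with n hvar hpos hneg hgap hsq hn
  set m := ⌊lam * n⌋₊
  have hnm : n ≤ m := natCast_le_floor_mul hlam.le n
  have hm : m ≤ 2 * n := floor_mul_le_two_mul hlam'.le n
  have hsum : ‖∑ k ∈ Finset.Ioc n m, asymmetry a k / ((k : ℂ) - n)‖ ≤ ε / 6 + ε / 6 := by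
    simp only [asymmetry, sub_div, Finset.sum_sub_distrib]
    exact (norm_sub_le _ _).trans (add_le_add (hpos m hnm hm) (hneg m hnm hm))
  have hwide : (n : ℝ) ≤ ((m : ℝ) - n + 1) ^ 2 :=
    hsq.trans (pow_le_pow_left₀ (mul_nonneg (by linarith) n.cast_nonneg) (by linarith) 2)
  rw [Real.dist_0_eq_abs, abs_of_nonneg (mul_nonneg (norm_nonneg _) (log_natCast_nonneg n))]
  linarith [norm_mul_log_le (asymmetry a) hn hnm hwide,
    logVariation_mono (asymmetry a) n m.le_succ]

theorem tendsto_norm_neg_mul_log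
    (hpos : Tendsto (fun n : ℕ => ‖a n‖ * log n) atTop (𝓝 0))
    (hasym : Tendsto (fun n : ℕ => ‖asymmetry a n‖ * log n) atTop (𝓝 0)) :
    Tendsto (fun n : ℕ => ‖a (-n)‖ * log n) atTop (𝓝 0) := by
  refine squeeze_zero (fun n => mul_nonneg (norm_nonneg _) (log_natCast_nonneg n)) (fun n => ?_)
    (by simpa using hpos.add hasym)
  rw [← add_mul]
  refine mul_le_mul_of_nonneg_right ?_ (log_natCast_nonneg n)
  simpa [asymmetry] using norm_sub_le (a n) (asymmetry a n)

theorem exists_eventually_L1norm_shell_le (hb : Balanced a) (hGBV : GBV fun n => a n)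
    (hpos : Tendsto (fun n : ℕ => ‖a n‖ * log n) atTop (𝓝 0))
    (hneg : Tendsto (fun n : ℕ => ‖a (-n)‖ * log n) atTop (𝓝 0)) {ε : ℝ} (hε : 0 < ε) :
    ∃ lam : ℝ, 1 < lam ∧ ∀ᶠ n : ℕ in atTop, ∀ j, n ≤ j → j ≤ ⌊lam * n⌋₊ →
      L1norm (trigPoly a (shell n j)) ≤ ε := by
  obtain ⟨C, hC, hshell⟩ := exists_L1norm_trigPoly_shell_le
  have hδ : 0 < ε / (7 * C) := by positivity
  have hδε : C * (7 * (ε / (7 * C))) = ε := by field_simp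
  obtain ⟨lam, hlam, hlam', hasym⟩ := hb _ hδ
  refine ⟨lam, hlam, ?_⟩
  filter_upwards [hasym, (hGBV.tendsto_logVariation hpos).eventually_le_const hδ,
    eventually_forall_ge_atTop.2 (hpos.eventually_le_const hδ),
    eventually_forall_ge_atTop.2 (hneg.eventually_le_const hδ), eventually_ge_atTop 2]
    with n hasym hvar hpos hneg hn j hnj hj
  have hvar_pos : logVariation (fun k => a k) n j ≤ ε / (7 * C) :=
    (logVariation_mono _ n (by linarith [floor_mul_le_two_mul hlam'.le n])).trans hvar
  have hvar_asym : logVariation (asymmetry a) n j ≤ ε / (7 * C) :=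
    (logVariation_mono _ n (hj.trans (Nat.le_succ _))).trans hasym
  have hvar_neg : logVariation (fun k => a (-k)) n j ≤ ε / (7 * C) + ε / (7 * C) := by
    have hdiff : (fun k : ℕ => a (-k)) = (fun k : ℕ => a k) - asymmetry a :=
      funext fun k => (sub_sub_cancel (a k) (a (-k))).symm
    rw [hdiff]
    exact (logVariation_sub_le _ _ n j).trans (add_le_add hvar_pos hvar_asym)
  refine (hshell a n j hn hnj).trans ((mul_le_mul_of_nonneg_left ?_ hC.le).trans_eq hδε)
  linarith [hpos n le_rfl, hpos j hnj, hneg n le_rfl, hneg j hnj]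

theorem tendsto_mul_log_cofinite_iff (a : ℤ → ℂ) :
    Tendsto (fun n : ℤ => a n * ((log |(n : ℝ)| : ℝ) : ℂ)) cofinite (𝓝 0) ↔
      Tendsto (fun n : ℕ => ‖a n‖ * log n) atTop (𝓝 0) ∧
        Tendsto (fun n : ℕ => ‖a (-n)‖ * log n) atTop (𝓝 0) := by
  have hatBot : (atBot : Filter ℤ) = map Neg.neg (map ((↑) : ℕ → ℤ) atTop) := by
    rw [Nat.map_cast_int_atTop, map_neg_atTop]
  rw [tendsto_zero_iff_norm_tendsto_zero, Int.cofinite_eq, tendsto_sup, and_comm, hatBot,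
    ← Nat.map_cast_int_atTop, tendsto_map'_iff, tendsto_map'_iff, tendsto_map'_iff]
  simp [Function.comp_def, abs_of_nonneg, log_natCast_nonneg]

end Balance

end L1Fourier

theorem theorem1 (f : ℝ → ℂ) (hper : Function.Periodic f (2 * π))
    (hint : IntervalIntegrable f volume (-π) π)
    (hbal : Tendsto
      (fun lam : ℝ => limsup (fun n : ℕ => ((L1Fourier.balanceSum f lam n : ℝ) : EReal)) atTop)
      (𝓝[>] (1 : ℝ)) (𝓝 (0 : EReal)))
    (hGBV : L1Fourier.GBV (fun n : ℕ => L1Fourier.fhat f (n : ℤ))) :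
    Tendsto (fun n : ℕ => L1Fourier.L1norm (fun x => f x - L1Fourier.partialSum f n x))
        atTop (𝓝 0) ↔
      Tendsto (fun n : ℤ => L1Fourier.fhat f n * ((Real.log |(n : ℝ)| : ℝ) : ℂ))
        cofinite (𝓝 0) := by
  have hb : L1Fourier.Balanced (L1Fourier.fhat f) := L1Fourier.balanced_fhat hbal
  rw [L1Fourier.tendsto_mul_log_cofinite_iff]
  constructor
  · intro hlim
    have hcauchy := L1Fourier.cauchyL1_fhat hint hlim
    have hpos := hGBV.tendsto_norm_mul_log hcauchy.tendsto_sum_Ioc_div_sub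
    have hasym := hb.tendsto_norm_asymmetry_mul_log hcauchy
    exact ⟨hpos, L1Fourier.tendsto_norm_neg_mul_log hpos hasym⟩
  · rintro ⟨hpos, hneg⟩
    exact L1Fourier.tendsto_L1norm_sub_partialSum hint fun ε hε =>
      L1Fourier.exists_eventually_L1norm_shell_le hb hGBV hpos hneg hε
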